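/- For $\tau=\tau_1\cdots\tau_j\in S_j$ let $\tau^r=\tau_j\cdots\tau_1$ be its reverse and $\tau^c=(j+1-\tau_1)\cdots(j+1-\tau_j)$ its complement. For a word $w$ of distinct integers, $\mathrm{red}(w)$ is obtained by replacing the $i$-th smallest letter of $w$ by $i$. Write each cycle of $\sigma\in S_n$ (fixed points included) as $C=(c_0,c_1,\dots,c_{p-1})$ with $c_{s+1}=\sigma(c_s)$ and $c_0$ the smallest element. We say that $\sigma$ has a cycle $\tau$-match if some cycle $C$ of $\sigma$ has length $p\ge j$ and $\mathrm{red}(c_rc_{r+1}\cdots c_{r+j-1})=\tau$ for some $r$, with indices read modulo $p$. Put $\mathrm{cdes}(C)=1+|\{0\le s<p-1: c_s>c_{s+1}\}|$ (so $\mathrm{cdes}(C)=1$ for a one-cycle), let $\mathrm{cdes}(\sigma)$ be the sum of $\mathrm{cdes}(C)$ over all cycles $C$ of $\sigma$, and let $\mathrm{cyc}(\sigma)$ be the number of cycles of $\sigma$. Define the formal power series $$NCM_\tau(t,x,y)=1+\sum_{n\ge1}\frac{t^n}{n!}\sum_{\sigma}x^{\mathrm{cyc}(\sigma)}y^{\mathrm{cdes}(\sigma)},$$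 where $\sigma$ runs over the permutations in $S_n$ with no cycle $\tau$-matches. **Theorem.** Let $j\ge 2$ and $\tau\in S_j$. Then, as formal power series in $t$, $$NCM_{\tau^r}(t,x,y)=NCM_{\tau^c}(t,x,y)=\exp\Bigl(x\bigl(yt-t+\ln NCM_\tau(ty,1,y^{-1})\bigr)\Bigr).$$ This holds for the two variables $x,y$ and, more generally, for any element $x$ and any invertible element $y$ of a commutative $\mathbb{Q}$-algebra. -/

import Mathlib

/-!
Permutations of `{1, …, n}` are elements of `Equiv.Perm (Fin n)`; positions and values are shifted
down by one, so that `σ i` is the entry of the one-line notation at position `i`.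
-/

namespace CyclePattern

open Finset

/-- The reverse `τ^r = τ_j ⋯ τ_1` of a permutation `τ = τ_1 ⋯ τ_j` in one-line notation. -/
def reverse {j : ℕ} (τ : Equiv.Perm (Fin j)) : Equiv.Perm (Fin j) := Fin.revPerm.trans τ

/-- The complement `τ^c = (j + 1 - τ_1) ⋯ (j + 1 - τ_j)` of `τ = τ_1 ⋯ τ_j`. -/
def complement {j : ℕ} (τ : Equiv.Perm (Fin j)) : Equiv.Perm (Fin j) := τ.trans Fin.revPerm

/-- The reduction of a word with distinct letters: the `i`-th smallest letter is replaced by `i`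
(counted from `0`), that is, each letter is replaced by the number of smaller letters. -/
def red {j n : ℕ} (w : Fin j → Fin n) (i : Fin j) : ℕ := #{k | w k < w i}

/-- The smallest elements of the cycles of `σ` (a fixed point is a cycle of length one). There is
one for each cycle. -/
def cycleMins {n : ℕ} (σ : Equiv.Perm (Fin n)) : Finset (Fin n) :=
  {a | ∀ b, σ.SameCycle a b → a ≤ b}

/-- The length `p` of the cycle of `σ` that contains `a`. -/
def cycleLen {n : ℕ} (σ : Equiv.Perm (Fin n)) (a : Fin n) : ℕ := #{b | σ.SameCycle a b}

/-- The entry `c_s` of the cycle `(c_0, c_1, …, c_{p-1})` of `σ` with `c_0 = a`. As `c_s = σ^s a`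
has period `p` in `s`, the index is automatically read modulo `p`. -/
def cycleEntry {n : ℕ} (σ : Equiv.Perm (Fin n)) (a : Fin n) (s : ℕ) : Fin n := (σ ^ s) a

/-- The number of cycles of `σ`, fixed points included. -/
def cyc {n : ℕ} (σ : Equiv.Perm (Fin n)) : ℕ := #(cycleMins σ)

/-- `cdes C = 1 + des (c_0 ⋯ c_{p-1})` for the cycle `C = (c_0, …, c_{p-1})` of `σ` with smallest
element `c_0 = a`. -/
def cdesCycle {n : ℕ} (σ : Equiv.Perm (Fin n)) (a : Fin n) : ℕ :=
  1 + #{s ∈ range (cycleLen σ a) |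
    s + 1 < cycleLen σ a ∧ cycleEntry σ a (s + 1) < cycleEntry σ a s}

/-- `cdes σ` is the sum of `cdes C` over the cycles `C` of `σ`. -/
def cdes {n : ℕ} (σ : Equiv.Perm (Fin n)) : ℕ := ∑ a ∈ cycleMins σ, cdesCycle σ a

/-- `σ` has a cycle `τ`-match: some cycle `(c_0, …, c_{p-1})` of `σ`, with `c_0` its smallest
element, has length `p ≥ j` and satisfies `red (c_r c_{r+1} ⋯ c_{r+j-1}) = τ` for some `r`,
where indices are taken modulo `p`. -/
def HasCycleMatch {j n : ℕ} (τ : Equiv.Perm (Fin j)) (σ : Equiv.Perm (Fin n)) : Prop :=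
  ∃ a ∈ cycleMins σ, j ≤ cycleLen σ a ∧ ∃ r < cycleLen σ a,
    ∀ i : Fin j, red (fun k : Fin j => cycleEntry σ a (r + k)) i = τ i

instance {j n : ℕ} (τ : Equiv.Perm (Fin j)) (σ : Equiv.Perm (Fin n)) :
    Decidable (HasCycleMatch τ σ) := by
  unfold HasCycleMatch; infer_instance

/-- The permutations in `S_n` that have no cycle `τ`-matches. -/
def NCMS {j : ℕ} (τ : Equiv.Perm (Fin j)) (n : ℕ) : Finset (Equiv.Perm (Fin n)) :=
  {σ | ¬ HasCycleMatch τ σ}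

/-- The generating function
`NCM_τ(t, x, y) = 1 + ∑_{n ≥ 1} t^n / n! ∑_{σ ∈ NCMS τ n} x^(cyc σ) y^(cdes σ)`,
a formal power series in `t` whose coefficients are evaluated at the elements `x`, `y` of a
commutative `ℚ`-algebra `R` (for instance at the two variables of a polynomial ring). -/
noncomputable def NCM {R : Type*} [CommRing R] [Algebra ℚ R] {j : ℕ} (τ : Equiv.Perm (Fin j))
    (x y : R) : PowerSeries R :=
  1 + PowerSeries.mk fun n => if n = 0 then 0 else
    algebraMap ℚ R (1 / (n.factorial : ℚ)) * ∑ σ ∈ NCMS τ n, x ^ cyc σ * y ^ cdes σ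

/-- `NCM_τ(t, x, y)` has constant term `1`, so its formal logarithm makes sense. -/
theorem constantCoeff_NCM {R : Type*} [CommRing R] [Algebra ℚ R] {j : ℕ}
    (τ : Equiv.Perm (Fin j)) (x y : R) : PowerSeries.constantCoeff (NCM τ x y) = 1 := by
  rw [NCM, map_add, map_one, ← PowerSeries.coeff_zero_eq_constantCoeff_apply,
    PowerSeries.coeff_mk, if_pos rfl, add_zero]

/-- The exponential `e^f = ∑ f^k / k!` of a power series `f` with constant term `0`. -/
noncomputable def expOf {R : Type*} [CommRing R] [Algebra ℚ R] (f : PowerSeries R) :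
    PowerSeries R := (PowerSeries.exp R).subst f

/-- The exponent `x (y t - t + ln NCM_τ(t y, 1, y⁻¹))` has constant term `0`, so its exponential
makes sense. Here `t` is `PowerSeries.X`, `PowerSeries.rescale y` substitutes `t y` for `t`, and
`PowerSeries.logOf` is the formal logarithm of a series with constant term `1`. -/
theorem constantCoeff_exponent {R : Type*} [CommRing R] [Algebra ℚ R] {j : ℕ}
    (τ : Equiv.Perm (Fin j)) (x : R) (y : Rˣ) :
    PowerSeries.constantCoeff (PowerSeries.C x *
      (PowerSeries.C (y : R) * PowerSeries.X - PowerSeries.X +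
        PowerSeries.logOf (PowerSeries.rescale (y : R) (NCM τ 1 ((y⁻¹ : Rˣ) : R))))) = 0 := by
  have h : PowerSeries.constantCoeff
      (PowerSeries.rescale (y : R) (NCM τ 1 ((y⁻¹ : Rˣ) : R))) = 1 := by
    rw [← PowerSeries.coeff_zero_eq_constantCoeff_apply, PowerSeries.coeff_rescale, pow_zero,
      one_mul, PowerSeries.coeff_zero_eq_constantCoeff_apply, constantCoeff_NCM]
  simp [PowerSeries.constantCoeff_logOf h]

end CyclePattern

/-! A permutation is a set of cycles, and matches, `cyc` and `cdes` are read off cycle by cycle.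
Hence the exponential formula: `NCM τ x y` is the exponential of `cycleSeries τ x y`
(`NCM_eq_expOf`). It comes from `permSum_succ`, which removes the cycle of the smallest point and
amounts to the equation `F' = L' F`.

It remains to compare single cycles. The return of a cycle to its minimum is never an ascent, so
`cdes` counts the points with `σ b ≤ b` (`cdes_eq`). Inverting a cycle turns `τ`-matches into
`τ^r`-matches, complementing its letters turns them into `τ^c`-matches, and both exchange cyclic
ascents and descents. In a cycle of length `p ≥ 2` these add up to `p`, so `y^cdes` becomes `y^p
(y⁻¹)^cdes`, which is the substitution of `ty` for `t` and `y⁻¹` for `y`. Only fixed points deviate: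
they contribute `yt` on one side and `t` on the other, whence `yt - t`. -/

namespace CyclePattern

open Finset

/-! ### Exponential and logarithm through the equation `F' = L' F` -/

section PowerSeriesODE

open PowerSeries

variable {R : Type*} [CommRing R] [Algebra ℚ R]

/-- Two solutions of `F' = G F` with the same constant coefficient are equal. -/
theorem eq_of_derivative_eq_mul {F₁ F₂ G : PowerSeries R}
    (h₁ : derivative R F₁ = G * F₁) (h₂ : derivative R F₂ = G * F₂)
    (h₀ : constantCoeff F₁ = constantCoeff F₂) : F₁ = F₂ := by
  rw [← sub_eq_zero]
  set D := F₁ - F₂ with hD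
  have hD' : derivative R D = G * D := by rw [hD, map_sub, h₁, h₂, mul_sub]
  ext n
  rw [map_zero]
  induction n using Nat.strong_induction_on with
  | _ n ih =>
    rcases n with _ | n
    · simp [hD, h₀]
    · have h := congrArg (coeff n) hD'
      rw [coeff_derivative, coeff_mul, Finset.sum_eq_zero] at h
      -- Once the lower coefficients vanish, `D' = G D` says that `n + 1` kills coefficient `n + 1`;
      -- over `ℚ` this integer is a unit.
      · have hu : IsUnit ((n : R) + 1) := by
          have : IsUnit (algebraMap ℚ R ((n : ℚ) + 1)) :=
            (IsUnit.mk0 _ (by positivity)).map _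
          simpa using this
        exact hu.mul_left_eq_zero.1 h
      · rintro ⟨a, b⟩ hab
        have : b < n + 1 := by have := mem_antidiagonal.1 hab; simp at this; omega
        simp only
        rw [ih b this, mul_zero]

theorem constantCoeff_expOf {f : PowerSeries R} (hf : constantCoeff f = 0) :
    constantCoeff (expOf f) = 1 := by
  have hs : HasSubst f := HasSubst.of_constantCoeff_zero' hf
  have h : expOf f = 1 + (exp R - 1).subst f := by
    rw [expOf, ← coe_substAlgHom hs, map_sub, map_one]; ring
  rw [h, map_add, map_one]
  have := constantCoeff_subst_eq_zero (R := R) (S := R) (a := f) hf (exp R - 1)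
    (by simp)
  erw [this, add_zero]

theorem derivative_expOf {f : PowerSeries R} (hf : constantCoeff f = 0) :
    derivative R (expOf f) = derivative R f * expOf f := by
  rw [expOf, derivative_subst (HasSubst.of_constantCoeff_zero' hf), derivative_exp, mul_comm]

/-- The logarithmic derivative of a power series with constant coefficient `1`. -/
theorem derivative_logOf_mul {f : PowerSeries R} (hf : constantCoeff f = 1) :
    derivative R (logOf f) * f = derivative R f := by
  have hs : HasSubst (f - 1) := HasSubst.of_constantCoeff_zero' (by simp [hf])
  -- `log R` is the series of `ln (1 + X)`; substituting `f - 1` for `X` then turns `1 + X` into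
  -- `f`.
  have h : derivative R (log R) * (1 + X) = 1 := by
    ext n
    rw [deriv_log, mul_add, mul_one, map_add]
    rcases n with _ | n
    · simp
    · simp [coeff_succ_mul_X, pow_succ, coeff_one]
  have h' := congrArg (substAlgHom (R := R) hs) h
  rw [map_mul, map_add, map_one, coe_substAlgHom, subst_X hs, add_sub_cancel] at h'
  rw [logOf_eq, derivative_subst hs, map_sub, derivative_one, sub_zero, mul_right_comm, h',
    one_mul]

/-- If `F' = L' F` and `F`, `L` have constant coefficients `1`, `0`, then `ln F = L`. -/
theorem logOf_eq_of_derivative_eq_mul {F L : PowerSeries R} (hF : constantCoeff F = 1)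
    (hL : constantCoeff L = 0) (h : derivative R F = derivative R L * F) : logOf F = L := by
  have hu : IsUnit F := isUnit_iff_constantCoeff.2 (by rw [hF]; exact isUnit_one)
  have hd : derivative R (logOf F) = derivative R L :=
    hu.mul_right_cancel ((derivative_logOf_mul hF).trans h)
  rw [← sub_eq_zero]
  refine eq_of_derivative_eq_mul (G := 0) (by rw [map_sub, hd]; simp) (by simp) ?_
  simp [constantCoeff_logOf hF, hL]

/-- If `F' = L' F` and `F`, `L` have constant coefficients `1`, `0`, then `F = e^L`. -/
theorem eq_expOf_of_derivative_eq_mul {F L : PowerSeries R} (hF : constantCoeff F = 1)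
    (hL : constantCoeff L = 0) (h : derivative R F = derivative R L * F) : F = expOf L :=
  eq_of_derivative_eq_mul h (derivative_expOf hL) (by rw [hF, constantCoeff_expOf hL])

end PowerSeriesODE

/-! ### Local weights and removal of a cycle -/

section Weights

open Equiv

/-- The word `a, σ a, …, σ^(j-1) a` reduces to `τ`. -/
def IsMatchAt {α : Type*} [LinearOrder α] {j : ℕ} (τ : Perm (Fin j)) (σ : Perm α) (a : α) : Prop :=
  ∀ i : Fin j, #{k : Fin j | (σ ^ (k : ℕ)) a < (σ ^ (i : ℕ)) a} = (τ i : ℕ)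

/-- The point `a` is the smallest element of its cycle. -/
def IsCycleMin {α : Type*} [LinearOrder α] (σ : Perm α) (a : α) : Prop :=
  ∀ b, σ.SameCycle a b → a ≤ b

variable {R : Type*} [CommRing R] {j : ℕ}

open Classical in
/-- The contribution of the point `a` to the weight of `σ`. -/
noncomputable def pointWeight {α : Type*} [LinearOrder α] (τ : Perm (Fin j)) (x y : R)
    (σ : Perm α) (a : α) : R :=
  (if IsMatchAt τ σ a then 0 else 1) * (if IsCycleMin σ a then x else 1) *
    (if σ a ≤ a then y else 1)

/-- The weight of `σ`: zero if there is a match, otherwise `x` to the number of cycles times `y` to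
the number of weak descents `σ a ≤ a`. -/
noncomputable def permWeight {α : Type*} [LinearOrder α] [Fintype α] (τ : Perm (Fin j)) (x y : R)
    (σ : Perm α) : R := ∏ a, pointWeight τ x y σ a

section Transport

variable {α β : Type*} [LinearOrder α] [LinearOrder β] {σ : Perm α} {ρ : Perm β} {e : β ↪o α}

theorem zpow_apply_embedding (h : ∀ b, σ (e b) = e (ρ b)) (z : ℤ) (b : β) :
    (σ ^ z) (e b) = e ((ρ ^ z) b) := by
  have hn : ∀ (n : ℕ) b, (σ ^ n) (e b) = e ((ρ ^ n) b) := by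
    intro n
    induction n with
    | zero => simp
    | succ n ih => intro b; rw [pow_succ, pow_succ, Perm.mul_apply, Perm.mul_apply, h, ih]
  rcases z with n | n
  · simpa using hn n b
  · rw [zpow_negSucc, zpow_negSucc, Perm.inv_eq_iff_eq, hn, ← Perm.mul_apply, mul_inv_cancel,
      Perm.one_apply]

theorem sameCycle_embedding_iff (h : ∀ b, σ (e b) = e (ρ b)) (b : β) (a : α) :
    σ.SameCycle (e b) a ↔ ∃ c, ρ.SameCycle b c ∧ e c = a := by
  constructor
  · rintro ⟨z, rfl⟩
    exact ⟨_, ⟨z, rfl⟩, (zpow_apply_embedding h z b).symm⟩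
  · rintro ⟨_, ⟨z, rfl⟩, rfl⟩
    exact ⟨z, zpow_apply_embedding h z b⟩

theorem isMatchAt_embedding_iff (τ : Perm (Fin j)) (h : ∀ b, σ (e b) = e (ρ b)) (b : β) :
    IsMatchAt τ σ (e b) ↔ IsMatchAt τ ρ b := by
  have hn (n : ℕ) : (σ ^ n) (e b) = e ((ρ ^ n) b) := by
    simpa using zpow_apply_embedding h (n : ℤ) b
  simp only [IsMatchAt, hn, OrderEmbedding.lt_iff_lt]

theorem isCycleMin_embedding_iff (h : ∀ b, σ (e b) = e (ρ b)) (b : β) :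
    IsCycleMin σ (e b) ↔ IsCycleMin ρ b := by
  simp only [IsCycleMin, sameCycle_embedding_iff h]
  constructor
  · intro H c hc
    exact e.le_iff_le.1 (H _ ⟨c, hc, rfl⟩)
  · rintro H _ ⟨c, hc, rfl⟩
    exact e.le_iff_le.2 (H c hc)

/-- The weight at a point depends only on the relative order of its orbit. This covers both
relabelling (`e` bijective) and restriction to a union of cycles. -/
theorem pointWeight_embedding (τ : Perm (Fin j)) (x y : R) (h : ∀ b, σ (e b) = e (ρ b)) (b : β) :
    pointWeight τ x y σ (e b) = pointWeight τ x y ρ b := by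
  classical
  rw [pointWeight, pointWeight, if_congr (isMatchAt_embedding_iff τ h b) rfl rfl,
    if_congr (isCycleMin_embedding_iff h b) rfl rfl, h, if_congr e.le_iff_le rfl rfl]

theorem permWeight_permCongr [Fintype α] [Fintype β] (τ : Perm (Fin j)) (x y : R) (f : β ≃o α)
    (ρ : Perm β) : permWeight τ x y (f.toEquiv.permCongr ρ) = permWeight τ x y ρ := by
  refine (Fintype.prod_equiv f.toEquiv _ _ fun b => ?_).symm
  exact (pointWeight_embedding (e := f.toOrderEmbedding) τ x y (by simp) b).symm

theorem permWeight_subtypeCongr [Fintype α] {p : α → Prop} [DecidablePred p] (τ : Perm (Fin j))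
    (x y : R) (ρ : Perm {a // p a}) (π : Perm {a // ¬p a}) :
    permWeight τ x y (Perm.subtypeCongr ρ π) = permWeight τ x y ρ * permWeight τ x y π := by
  rw [permWeight, ← Fintype.prod_subtype_mul_prod_subtype p]
  congr 1
  · exact prod_congr rfl fun b _ => pointWeight_embedding (e := OrderEmbedding.subtype p) τ x y
      (by simp) b
  · exact prod_congr rfl fun b _ => pointWeight_embedding
      (e := OrderEmbedding.subtype fun a => ¬p a) τ x y (by simp) b

end Transport

/-- All points are on one cycle of `σ`. -/
def IsTransitive {α : Type*} (σ : Perm α) : Prop := ∀ a b, σ.SameCycle a b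

/-- The total weight of all permutations of `α`. -/
noncomputable def permSum (α : Type*) [LinearOrder α] [Fintype α] (τ : Perm (Fin j)) (x y : R) : R :=
  ∑ σ : Perm α, permWeight τ x y σ

open Classical in
/-- The total weight of the permutations of `α` that have a single cycle. -/
noncomputable def cycleSum (α : Type*) [LinearOrder α] [Fintype α] (τ : Perm (Fin j)) (x y : R) :
    R := ∑ σ : Perm α with IsTransitive σ, permWeight τ x y σ

theorem permSum_congr {α β : Type*} [LinearOrder α] [LinearOrder β] [Fintype α] [Fintype β]
    (f : β ≃o α) (τ : Perm (Fin j)) (x y : R) : permSum β τ x y = permSum α τ x y :=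
  Fintype.sum_equiv f.toEquiv.permCongr _ _ fun ρ => (permWeight_permCongr τ x y f ρ).symm

theorem isTransitive_permCongr {α β : Type*} (f : β ≃ α) (ρ : Perm β) :
    IsTransitive (f.permCongr ρ) ↔ IsTransitive ρ := by
  have hz (z : ℤ) : f.permCongr ρ ^ z = f.permCongr (ρ ^ z) :=
    (map_zpow f.permCongrHom ρ z).symm
  have key (a b) : (f.permCongr ρ).SameCycle (f a) (f b) ↔ ρ.SameCycle a b := by
    simp [Perm.SameCycle, hz]
  constructor
  · intro h a b
    exact (key a b).1 (h _ _)
  · intro h a b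
    obtain ⟨a, rfl⟩ := f.surjective a
    obtain ⟨b, rfl⟩ := f.surjective b
    exact (key a b).2 (h _ _)

theorem cycleSum_congr {α β : Type*} [LinearOrder α] [LinearOrder β] [Fintype α] [Fintype β]
    (f : β ≃o α) (τ : Perm (Fin j)) (x y : R) : cycleSum β τ x y = cycleSum α τ x y := by
  refine sum_equiv f.toEquiv.permCongr (fun ρ => ?_)
    fun ρ _ => (permWeight_permCongr τ x y f ρ).symm
  simp [isTransitive_permCongr]

open Classical in
-- If `p` is the cycle of `a₀`, it is invariant, so `σ` splits uniquely into a single cycle on `p`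
-- and an arbitrary permutation of the rest; weights multiply.
theorem sum_permWeight_filter {α : Type*} [LinearOrder α] [Fintype α] (p : α → Prop) (a₀ : α)
    (h₀ : p a₀) (τ : Perm (Fin j)) (x y : R) :
    ∑ σ : Perm α with ∀ a, σ.SameCycle a₀ a ↔ p a, permWeight τ x y σ =
      cycleSum {a // p a} τ x y * permSum {a // ¬p a} τ x y := by
  rw [cycleSum, permSum, sum_mul_sum, ← sum_product']
  symm
  refine sum_bij (fun q _ => Perm.subtypeCongr q.1 q.2) ?_ ?_ ?_ ?_
  · rintro ⟨ρ, π⟩ h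
    have hρ : IsTransitive ρ := by simpa using h
    simp only [mem_filter, mem_univ, true_and]
    intro a
    have := sameCycle_embedding_iff (σ := Perm.subtypeCongr ρ π) (ρ := ρ)
      (e := OrderEmbedding.subtype p) (by simp) ⟨a₀, h₀⟩ a
    simp only [OrderEmbedding.subtype_apply] at this
    rw [this]
    constructor
    · rintro ⟨c, -, rfl⟩
      exact c.2
    · intro ha
      exact ⟨⟨a, ha⟩, hρ _ _, rfl⟩
  · rintro q - q' - h
    exact Perm.subtypeCongrHom_injective p h
  · intro σ h
    simp only [mem_filter, mem_univ, true_and] at h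
    have hp (a) : p (σ a) ↔ p a := by rw [← h, ← h, Perm.sameCycle_apply_right]
    refine ⟨(σ.subtypePerm hp, σ.subtypePerm fun a => not_congr (hp a)), ?_, ?_⟩
    · simp only [mem_product, mem_filter, mem_univ, true_and, and_true]
      rintro ⟨a, ha⟩ ⟨b, hb⟩
      rw [Perm.sameCycle_subtypePerm]
      exact ((h a).2 ha).symm.trans ((h b).2 hb)
    · ext a
      by_cases ha : p a
      · simp [Perm.subtypeCongr.left_apply, ha]
      · simp [Perm.subtypeCongr.right_apply, ha]
  · rintro ⟨ρ, π⟩ -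
    exact (permWeight_subtypeCongr τ x y ρ π).symm

open Classical in
/-- Removing the cycle of the smallest point. -/
theorem permSum_succ (n : ℕ) (τ : Perm (Fin j)) (x y : R) :
    permSum (Fin (n + 1)) τ x y = ∑ m ∈ range (n + 1),
      (n.choose m : R) * (cycleSum (Fin (m + 1)) τ x y * permSum (Fin (n - m)) τ x y) := by
  have h : permSum (Fin (n + 1)) τ x y = ∑ T : Finset (Fin n),
      cycleSum (Fin (#T + 1)) τ x y * permSum (Fin (n - #T)) τ x y := by
    -- Group by the cycle of `0`; `T` records its other points, shifted down by one.
    rw [permSum, ← sum_fiberwise _ fun σ : Perm (Fin (n + 1)) =>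
      ({i | σ.SameCycle 0 (Fin.succ i)} : Finset (Fin n))]
    refine sum_congr rfl fun T _ => ?_
    obtain ⟨p, hp⟩ : ∃ p : Fin (n + 1) → Prop,
        ∀ a, p a ↔ a ∈ insert 0 (T.map (Fin.succEmb n)) := ⟨_, fun _ => Iff.rfl⟩
    have hc₁ : Fintype.card {a // p a} = #T + 1 := by
      rw [Fintype.card_subtype, filter_congr fun a _ => hp a, filter_univ_mem,
        card_insert_of_notMem (by simp [Fin.succ_ne_zero]), card_map]
    have hc₂ : Fintype.card {a // ¬p a} = n - #T := by
      rw [Fintype.card_subtype_compl, hc₁]; simp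
    rw [cycleSum_congr (Fintype.orderIsoFinOfCardEq _ hc₁),
      permSum_congr (Fintype.orderIsoFinOfCardEq _ hc₂)]
    refine Eq.trans (sum_congr ?_ fun _ _ => rfl) (sum_permWeight_filter p 0 (by simp [hp]) τ x y)
    ext σ
    simp only [mem_filter, mem_univ, true_and]
    constructor
    · rintro rfl a
      cases a using Fin.cases <;> simp [hp, Fin.succ_ne_zero, Perm.SameCycle.rfl]
    · intro h
      ext i
      simp [h, hp, Fin.succ_ne_zero]
  rw [h, ← powerset_univ, sum_powerset_apply_card
    (fun m => cycleSum (Fin (m + 1)) τ x y * permSum (Fin (n - m)) τ x y)]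
  simp

end Weights

/-! ### Cycle statistics as pointwise statistics -/

section Cycles

open Equiv

variable {R : Type*} [CommRing R] {j : ℕ}

open Classical in
/-- This is `1` if `σ` has no match, and `0` otherwise. -/
noncomputable def avoidance (R : Type*) [CommRing R] {α : Type*} [LinearOrder α]
    (τ : Perm (Fin j)) (σ : Perm α) : R := if ∃ a, IsMatchAt τ σ a then 0 else 1

theorem avoidance_congr {α : Type*} [LinearOrder α] {τ τ' : Perm (Fin j)} {σ σ' : Perm α}
    (h : (∃ a, IsMatchAt τ σ a) ↔ ∃ a, IsMatchAt τ' σ' a) :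
    avoidance R τ σ = avoidance R τ' σ' := by
  classical
  exact if_congr h rfl rfl

open Classical in
theorem permWeight_eq {α : Type*} [LinearOrder α] [Fintype α] (τ : Perm (Fin j)) (x y : R)
    (σ : Perm α) : permWeight τ x y σ =
      avoidance R τ σ * x ^ #{a | IsCycleMin σ a} * y ^ #{a | σ a ≤ a} := by
  simp only [permWeight, pointWeight, prod_mul_distrib, avoidance]
  congr 1
  · congr 1
    · split_ifs with h
      · obtain ⟨a, ha⟩ := h
        exact prod_eq_zero (mem_univ a) (if_pos ha)
      · exact prod_eq_one fun a _ => if_neg fun ha => h ⟨a, ha⟩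
    · rw [prod_ite, prod_const, prod_const_one, mul_one]
  · rw [prod_ite, prod_const, prod_const_one, mul_one]

/-- Equal letters would have equal ranks, but `τ` is injective. Hence a match needs a cycle of
length at least `j`, and that condition in `HasCycleMatch` is automatic. -/
theorem pow_apply_injective_of_isMatchAt {α : Type*} [LinearOrder α] {τ : Perm (Fin j)}
    {σ : Perm α} {a : α} (h : IsMatchAt τ σ a) :
    Function.Injective fun i : Fin j => (σ ^ (i : ℕ)) a := by
  intro i k hik
  simp only at hik
  apply τ.injective
  rw [Fin.ext_iff, ← h i, ← h k, hik]

variable {n : ℕ} (σ : Perm (Fin n)) (a : Fin n)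

theorem isCycleOn_filter_sameCycle :
    σ.IsCycleOn (({b | σ.SameCycle a b} : Finset (Fin n)) : Set (Fin n)) := by
  refine ⟨⟨fun b hb => ?_, σ.injective.injOn, fun b hb => ⟨σ⁻¹ b, ?_, by simp⟩⟩, fun b hb c hc => ?_⟩
  · simpa using hb
  · simp only [mem_coe, mem_filter, mem_univ, true_and] at hb ⊢
    rwa [← Perm.sameCycle_apply_right, ← Perm.mul_apply, mul_inv_cancel, Perm.one_apply]
  · simp only [mem_coe, mem_filter, mem_univ, true_and] at hb hc
    exact hb.symm.trans hc

theorem mem_filter_sameCycle_self : a ∈ ({b | σ.SameCycle a b} : Finset (Fin n)) := by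
  simp [Perm.SameCycle.rfl]

theorem exists_cycleEntry_eq {a b : Fin n} (h : σ.SameCycle a b) :
    ∃ s < cycleLen σ a, cycleEntry σ a s = b :=
  (isCycleOn_filter_sameCycle σ a).exists_pow_eq (mem_filter_sameCycle_self σ a) (by simpa using h)

theorem cycleEntry_injOn : Set.InjOn (cycleEntry σ a) (range (cycleLen σ a)) := by
  intro s hs t ht h
  have := ((isCycleOn_filter_sameCycle σ a).pow_apply_eq_pow_apply
    (mem_filter_sameCycle_self σ a)).1 h
  exact Nat.ModEq.eq_of_lt_of_lt this (mem_range.1 hs) (mem_range.1 ht)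

theorem cycleEntry_cycleLen : cycleEntry σ a (cycleLen σ a) = a :=
  (isCycleOn_filter_sameCycle σ a).pow_card_apply (mem_filter_sameCycle_self σ a)

theorem cycleEntry_succ (s : ℕ) : cycleEntry σ a (s + 1) = σ (cycleEntry σ a s) := by
  rw [cycleEntry, cycleEntry, pow_succ', Perm.mul_apply]

theorem cycleLen_pos : 0 < cycleLen σ a := card_pos.2 ⟨a, mem_filter_sameCycle_self σ a⟩

theorem image_cycleEntry :
    (range (cycleLen σ a)).image (cycleEntry σ a) = ({b | σ.SameCycle a b} : Finset (Fin n)) := by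
  ext b
  simp only [mem_image, mem_range, mem_filter, mem_univ, true_and]
  constructor
  · rintro ⟨s, -, rfl⟩
    exact Perm.sameCycle_pow_right.2 Perm.SameCycle.rfl
  · exact exists_cycleEntry_eq σ

/-- The last step of a cycle is always a descent, so `cdes` counts cyclic descents. -/
theorem cdesCycle_eq {a : Fin n} (ha : a ∈ cycleMins σ) :
    cdesCycle σ a = #{b | σ.SameCycle a b ∧ σ b ≤ b} := by
  simp only [cycleMins, mem_filter, mem_univ, true_and] at ha
  rw [filter_and, ← image_cycleEntry, inter_filter, inter_univ,
    filter_image, card_image_of_injOn ((cycleEntry_injOn σ a).mono (coe_subset.2 (filter_subset _ _))),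
    cdesCycle]
  obtain ⟨p, hp⟩ : ∃ p, cycleLen σ a = p + 1 := ⟨_, (Nat.sub_add_cancel (cycleLen_pos σ a)).symm⟩
  -- The index `s = p` is the return to the minimum: `cdesCycle` omits it and adds `1` instead.
  rw [hp, range_add_one, filter_insert, filter_insert, if_neg (by omega), if_pos, add_comm,
    card_insert_of_notMem (by simp)]
  · congr 2
    refine filter_congr fun s hs => ?_
    have hs : s < p := by simpa using hs
    rw [cycleEntry_succ]
    refine ⟨fun h => h.2.le, fun h => ⟨by omega, lt_of_le_of_ne h fun h' => ?_⟩⟩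
    rw [← cycleEntry_succ] at h'
    have := cycleEntry_injOn σ a (by simp; omega) (by simp; omega) h'
    omega
  · rw [← cycleEntry_succ, ← hp, cycleEntry_cycleLen]
    exact ha _ (Perm.sameCycle_pow_right.2 Perm.SameCycle.rfl)

theorem exists_mem_cycleMins (b : Fin n) : ∃ a ∈ cycleMins σ, σ.SameCycle a b := by
  obtain ⟨a, ha, hmin⟩ := exists_min_image ({c | σ.SameCycle c b} : Finset (Fin n)) id
    ⟨b, by simp [Perm.SameCycle.rfl]⟩
  simp only [mem_filter, mem_univ, true_and, id] at ha hmin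
  refine ⟨a, ?_, ha⟩
  simp only [cycleMins, mem_filter, mem_univ, true_and]
  exact fun c hc => hmin c (hc.symm.trans ha)

theorem cdes_eq : cdes σ = #{b | σ b ≤ b} := by
  rw [cdes, sum_congr rfl fun a ha => cdesCycle_eq σ ha, ← card_biUnion]
  · congr 1
    ext b
    simp only [mem_biUnion, mem_filter, mem_univ, true_and]
    constructor
    · rintro ⟨a, -, -, h⟩
      exact h
    · intro h
      obtain ⟨a, ha, hab⟩ := exists_mem_cycleMins σ b
      exact ⟨a, ha, hab, h⟩
  · intro a ha c hc hac
    refine disjoint_left.2 fun b hb hb' => ?_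
    simp only [cycleMins, mem_coe, mem_filter, mem_univ, true_and] at ha hc hb hb'
    have h := hb.1.trans hb'.1.symm
    exact hac (le_antisymm (ha c h) (hc a h.symm))

theorem hasCycleMatch_iff (τ : Perm (Fin j)) : HasCycleMatch τ σ ↔ ∃ a, IsMatchAt τ σ a := by
  have key (a : Fin n) (r : ℕ) : IsMatchAt τ σ (cycleEntry σ a r) ↔
      ∀ i : Fin j, red (fun k : Fin j => cycleEntry σ a (r + k)) i = τ i := by
    have (k : ℕ) : (σ ^ k) ((σ ^ r) a) = (σ ^ (r + k)) a := by
      rw [← Perm.mul_apply, ← pow_add, add_comm]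
    simp only [IsMatchAt, red, cycleEntry, this]
    congr!
  constructor
  · rintro ⟨a, -, -, r, -, h⟩
    exact ⟨_, (key a r).2 h⟩
  · rintro ⟨b, hb⟩
    obtain ⟨a, ha, hab⟩ := exists_mem_cycleMins σ b
    obtain ⟨r, hr, rfl⟩ := exists_cycleEntry_eq σ hab
    refine ⟨a, ha, ?_, r, hr, (key a r).1 hb⟩
    rw [cycleLen, ← Fintype.card_fin j, ← card_univ,
      ← card_image_of_injective _ (pow_apply_injective_of_isMatchAt hb)]
    refine card_le_card fun c hc => ?_
    obtain ⟨i, -, rfl⟩ := mem_image.1 hc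
    exact mem_filter.2 ⟨mem_univ _, Perm.sameCycle_pow_right.2 hab⟩

theorem sum_NCMS (τ : Perm (Fin j)) (x y : R) :
    ∑ σ ∈ NCMS τ n, x ^ cyc σ * y ^ cdes σ = permSum (Fin n) τ x y := by
  rw [permSum, NCMS, sum_filter]
  refine sum_congr rfl fun σ _ => ?_
  classical
  have hmin : cycleMins σ = univ.filter (IsCycleMin σ) := by
    ext; simp only [cycleMins, mem_filter, IsCycleMin]
  rw [permWeight_eq, cdes_eq, cyc, hmin, avoidance]
  by_cases h : HasCycleMatch τ σ
  · rw [if_neg (not_not.2 h), if_pos ((hasCycleMatch_iff σ τ).1 h), zero_mul, zero_mul]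
  · rw [if_pos h, if_neg (mt (hasCycleMatch_iff σ τ).2 h), one_mul]

end Cycles

/-! ### Reversal and complement of a single cycle -/

section SingleCycles

open Equiv

variable {R : Type*} [CommRing R] {j n : ℕ}

theorem permWeight_of_isTransitive {σ : Perm (Fin (n + 1))} (hσ : IsTransitive σ)
    (τ : Perm (Fin j)) (x y : R) : permWeight τ x y σ =
      avoidance R τ σ * x * y ^ #{a | σ a ≤ a} := by
  classical
  have : ({a | IsCycleMin σ a} : Finset (Fin (n + 1))) = {0} := by
    ext a
    simp only [mem_filter, mem_univ, true_and, mem_singleton]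
    constructor
    · exact fun h => le_antisymm (h 0 (hσ _ _)) (Fin.zero_le _)
    · rintro rfl b -
      exact Fin.zero_le b
  rw [permWeight_eq, this, card_singleton, pow_one]

theorem apply_ne_of_isTransitive {σ : Perm (Fin (n + 2))} (hσ : IsTransitive σ)
    (a : Fin (n + 2)) : σ a ≠ a := by
  intro h
  obtain ⟨b, hb⟩ := exists_ne a
  exact hb ((hσ a b).eq_of_left h).symm

/-- A cycle of length at least two has no fixed points, so the two sets are disjoint. For length one
the point would count twice. -/
theorem card_le_apply_add_card_apply_le {σ : Perm (Fin (n + 2))} (hσ : IsTransitive σ) :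
    #{a | a ≤ σ a} + #{a | σ a ≤ a} = n + 2 := by
  have : ({a | a ≤ σ a} : Finset (Fin (n + 2))) = ({a | ¬ σ a ≤ a} : Finset (Fin (n + 2))) :=
    filter_congr fun a _ => by
      rw [not_le]
      exact ⟨fun h => lt_of_le_of_ne h (apply_ne_of_isTransitive hσ a).symm, le_of_lt⟩
  rw [this, add_comm, card_filter_add_card_filter_not, card_fin]

/-- `σ⁻¹` traverses cycles backwards, so the reversed window starts at the last letter of the old
one. -/
theorem isMatchAt_reverse_inv_iff {α : Type*} [LinearOrder α] (τ : Perm (Fin j)) (σ : Perm α)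
    (b : α) : IsMatchAt (reverse τ) σ⁻¹ ((σ ^ (j - 1)) b) ↔ IsMatchAt τ σ b := by
  have h (i : Fin j) : (σ⁻¹ ^ (i : ℕ)) ((σ ^ (j - 1)) b) = (σ ^ (i.rev : ℕ)) b := by
    have : j - 1 = i + i.rev := by rw [Fin.val_rev]; omega
    rw [this, pow_add, ← Perm.mul_apply, ← mul_assoc, inv_pow, inv_mul_cancel, one_mul]
  simp only [IsMatchAt, h]
  rw [Fin.revPerm.forall_congr_left]
  refine forall_congr' fun i => ?_
  have : reverse τ (Fin.revPerm.symm i) = τ i := by simp [reverse]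
  rw [this]
  have hc : #{k : Fin j | (σ ^ (k.rev : ℕ)) b < (σ ^ (i : ℕ)) b} =
      #{k : Fin j | (σ ^ (k : ℕ)) b < (σ ^ (i : ℕ)) b} :=
    card_equiv Fin.revPerm (by simp)
  simp [← hc]

theorem exists_isMatchAt_reverse_inv_iff {α : Type*} [LinearOrder α] (τ : Perm (Fin j))
    (σ : Perm α) : (∃ a, IsMatchAt (reverse τ) σ⁻¹ a) ↔ ∃ a, IsMatchAt τ σ a := by
  simp only [← isMatchAt_reverse_inv_iff τ σ]
  exact (σ ^ (j - 1)).surjective.exists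

theorem card_lt_add_card_gt {α : Type*} [LinearOrder α] {w : Fin j → α}
    (hw : Function.Injective w) (i : Fin j) : #{k | w k < w i} + #{k | w i < w k} + 1 = j := by
  have h : ({k | w k ≤ w i} : Finset (Fin j)) = insert i ({k | w k < w i} : Finset (Fin j)) := by
    ext k
    simp only [mem_filter, mem_univ, true_and, mem_insert, le_iff_eq_or_lt, hw.eq_iff]
  have h' := card_filter_add_card_filter_not (s := (univ : Finset (Fin j))) fun k => w k ≤ w i
  rw [h, card_insert_of_notMem (by simp), card_fin] at h'
  simp only [not_le] at h'
  omega

theorem isMatchAt_complement_conj_iff {n : ℕ} (τ : Perm (Fin j)) (σ : Perm (Fin n)) (a : Fin n) :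
    IsMatchAt (complement τ) (Fin.revPerm * σ * Fin.revPerm⁻¹) a.rev ↔ IsMatchAt τ σ a := by
  have h (i : ℕ) : ((Fin.revPerm * σ * Fin.revPerm⁻¹ : Perm (Fin n)) ^ i) a.rev = ((σ ^ i) a).rev := by
    rw [conj_pow]
    simp [Perm.mul_apply, Perm.inv_def]
  -- Complementing sends rank `r` to `j - 1 - r` only if the letters are distinct; a match on either
  -- side guarantees this.
  have key (hw : Function.Injective fun i : Fin j => (σ ^ (i : ℕ)) a) :
      IsMatchAt (complement τ) (Fin.revPerm * σ * Fin.revPerm⁻¹) a.rev ↔ IsMatchAt τ σ a := by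
    simp only [IsMatchAt, h, Fin.rev_lt_rev]
    refine forall_congr' fun i => ?_
    have h₁ := card_lt_add_card_gt hw i
    have h₂ : (complement τ i : ℕ) = j - (τ i + 1) := by simp [complement, Fin.val_rev]
    have h₃ := (τ i).isLt
    rw [h₂]
    omega
  constructor
  · intro H
    refine (key ?_).1 H
    have := pow_apply_injective_of_isMatchAt H
    simp only [h] at this
    exact fun i k hik => this (congrArg Fin.rev hik)
  · intro H
    exact (key (pow_apply_injective_of_isMatchAt H)).2 H

theorem exists_isMatchAt_complement_conj_iff {n : ℕ} (τ : Perm (Fin j)) (σ : Perm (Fin n)) :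
    (∃ a, IsMatchAt (complement τ) (Fin.revPerm * σ * Fin.revPerm⁻¹) a) ↔
      ∃ a, IsMatchAt τ σ a := by
  simp only [← isMatchAt_complement_conj_iff τ σ]
  exact Fin.rev_surjective.exists

theorem pow_mul_inv_pow_of_add_eq {y : Rˣ} {k l m : ℕ} (h : k + l = m) :
    (y : R) ^ k = (y : R) ^ m * ((y⁻¹ : Rˣ) : R) ^ l := by
  rw [← h, pow_add, mul_assoc, ← mul_pow, Units.mul_inv, one_pow, mul_one]

/-- Inversion permutes the single cycles and turns an ascent at `a` into a descent of `σ⁻¹` at `σ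
a`. -/
theorem cycleSum_reverse (τ : Perm (Fin j)) (x : R) (y : Rˣ) :
    cycleSum (Fin (n + 2)) (reverse τ) x (y : R) =
      x * ((y : R) ^ (n + 2) * cycleSum (Fin (n + 2)) τ 1 ((y⁻¹ : Rˣ) : R)) := by
  classical
  rw [cycleSum, cycleSum, mul_sum, mul_sum]
  symm
  refine sum_equiv (Equiv.inv _) (fun σ => ?_) fun σ hσ => ?_
  · simp only [mem_filter, mem_univ, true_and, Equiv.inv_apply]
    simp only [IsTransitive, Perm.sameCycle_inv]
  have hσ : IsTransitive σ := by simpa using hσ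
  rw [Equiv.inv_apply, permWeight_of_isTransitive hσ,
    permWeight_of_isTransitive (σ := σ⁻¹) (by simpa [IsTransitive] using hσ),
    avoidance_congr (exists_isMatchAt_reverse_inv_iff τ σ)]
  have : #{a | σ⁻¹ a ≤ a} = #{a | a ≤ σ a} := card_equiv σ⁻¹ (by simp)
  rw [this, pow_mul_inv_pow_of_add_eq (card_le_apply_add_card_apply_le hσ)]
  ring

theorem cycleSum_complement (τ : Perm (Fin j)) (x : R) (y : Rˣ) :
    cycleSum (Fin (n + 2)) (complement τ) x (y : R) =
      x * ((y : R) ^ (n + 2) * cycleSum (Fin (n + 2)) τ 1 ((y⁻¹ : Rˣ) : R)) := by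
  classical
  have ht (σ : Perm (Fin (n + 2))) :
      IsTransitive (Fin.revPerm * σ * Fin.revPerm⁻¹) ↔ IsTransitive σ :=
    isTransitive_permCongr Fin.revPerm σ
  rw [cycleSum, cycleSum, mul_sum, mul_sum]
  symm
  refine sum_equiv (MulAut.conj Fin.revPerm).toEquiv (fun σ => by simp [ht]) fun σ hσ => ?_
  have hσ : IsTransitive σ := by simpa using hσ
  simp only [MulEquiv.toEquiv_eq_coe, MulEquiv.coe_toEquiv, MulAut.conj_apply]
  rw [permWeight_of_isTransitive hσ, permWeight_of_isTransitive ((ht σ).2 hσ),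
    avoidance_congr (exists_isMatchAt_complement_conj_iff τ σ)]
  have : #{a | (Fin.revPerm * σ * Fin.revPerm⁻¹ : Perm (Fin (n + 2))) a ≤ a} = #{a | a ≤ σ a} :=
    card_equiv Fin.revPerm fun a => by
      simp only [mem_filter, mem_univ, true_and, Fin.revPerm_apply, Perm.mul_apply, Perm.inv_def,
        Fin.revPerm_symm]
      exact Fin.rev_le_iff
  rw [this, pow_mul_inv_pow_of_add_eq (card_le_apply_add_card_apply_le hσ)]
  ring

/-- For `j ≤ 1` the fixed point itself would be a match. -/
theorem cycleSum_one (hj : 2 ≤ j) (τ : Perm (Fin j)) (x y : R) :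
    cycleSum (Fin 1) τ x y = x * y := by
  classical
  have ht : IsTransitive (1 : Perm (Fin 1)) := fun a b =>
    (Subsingleton.elim a b).sameCycle _
  have hm : ¬ ∃ a, IsMatchAt τ (1 : Perm (Fin 1)) a := by
    rintro ⟨a, ha⟩
    have := @pow_apply_injective_of_isMatchAt _ _ _ _ _ _ ha ⟨0, by omega⟩ ⟨1, by omega⟩
      (Subsingleton.elim _ _)
    simp at this
  have hf : ({σ : Perm (Fin 1) | IsTransitive σ} : Finset _) = {1} := by
    ext σ
    simp [Subsingleton.elim σ 1, ht]
  rw [cycleSum, hf, sum_singleton, permWeight_of_isTransitive ht, avoidance, if_neg hm]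
  simp

end SingleCycles

/-! ### The exponential formula and the conclusion -/

section GeneratingFunctions

open PowerSeries

theorem derivative_rescale {R : Type*} [CommRing R] (r : R) (f : PowerSeries R) :
    derivative R (rescale r f) = C r * rescale r (derivative R f) := by
  ext n
  simp only [coeff_derivative, coeff_rescale, coeff_C_mul]
  ring

variable {R : Type*} [CommRing R] [Algebra ℚ R] {j : ℕ}

/-- The exponential generating function of the permutations with a single cycle. -/
noncomputable def cycleSeries (τ : Equiv.Perm (Fin j)) (x y : R) : PowerSeries R :=
  PowerSeries.mk fun n => if n = 0 then 0 else
    algebraMap ℚ R (1 / (n.factorial : ℚ)) * cycleSum (Fin n) τ x y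

theorem constantCoeff_cycleSeries (τ : Equiv.Perm (Fin j)) (x y : R) :
    constantCoeff (cycleSeries τ x y) = 0 := by
  rw [← coeff_zero_eq_constantCoeff_apply, cycleSeries, coeff_mk, if_pos rfl]

theorem coeff_NCM (τ : Equiv.Perm (Fin j)) (x y : R) (n : ℕ) :
    coeff n (NCM τ x y) = algebraMap ℚ R (1 / (n.factorial : ℚ)) * permSum (Fin n) τ x y := by
  rw [NCM, map_add, coeff_mk, coeff_one, sum_NCMS]
  rcases n with _ | n
  · simp [permSum, permWeight]
  · simp

theorem algebraMap_one_div_factorial_mul (n : ℕ) :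
    algebraMap ℚ R (1 / ((n + 1).factorial : ℚ)) * (n + 1) =
      algebraMap ℚ R (1 / (n.factorial : ℚ)) := by
  have h : ((n : R) + 1) = algebraMap ℚ R (n + 1) := by simp
  rw [h, ← map_mul, Nat.factorial_succ]
  congr 1
  push_cast
  field_simp

/-- The binomial convolution in `permSum_succ` is a product of exponential generating functions;
differentiation accounts for the removed smallest point. -/
theorem derivative_NCM (τ : Equiv.Perm (Fin j)) (x y : R) :
    derivative R (NCM τ x y) = derivative R (cycleSeries τ x y) * NCM τ x y := by
  ext n
  rw [coeff_derivative, coeff_NCM, mul_right_comm, algebraMap_one_div_factorial_mul, permSum_succ,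
    coeff_mul, Nat.sum_antidiagonal_eq_sum_range_succ_mk, mul_sum]
  refine sum_congr rfl fun m hm => ?_
  have hm : m ≤ n := by simpa [Nat.lt_succ_iff] using hm
  simp only
  rw [coeff_derivative, coeff_NCM, cycleSeries, coeff_mk, if_neg (Nat.succ_ne_zero m)]
  have h : algebraMap ℚ R (1 / (n.factorial : ℚ)) * (n.choose m : R) =
      algebraMap ℚ R (1 / (m.factorial : ℚ)) * algebraMap ℚ R (1 / ((n - m).factorial : ℚ)) := by
    rw [← map_natCast (algebraMap ℚ R), ← map_mul, ← map_mul, Nat.cast_choose ℚ hm]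
    congr 1
    field_simp
  linear_combination cycleSum (Fin (m + 1)) τ x y * permSum (Fin (n - m)) τ x y *
    (h - algebraMap ℚ R (1 / ((n - m).factorial : ℚ)) *
      algebraMap_one_div_factorial_mul (R := R) m)

theorem NCM_eq_expOf (τ : Equiv.Perm (Fin j)) (x y : R) :
    NCM τ x y = expOf (cycleSeries τ x y) :=
  eq_expOf_of_derivative_eq_mul (constantCoeff_NCM τ x y) (constantCoeff_cycleSeries τ x y)
    (derivative_NCM τ x y)

theorem logOf_rescale_NCM (τ : Equiv.Perm (Fin j)) (r x y : R) :
    logOf (rescale r (NCM τ x y)) = rescale r (cycleSeries τ x y) := by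
  have hc (f : PowerSeries R) : constantCoeff (rescale r f) = constantCoeff f := by
    rw [← coeff_zero_eq_constantCoeff_apply, coeff_rescale, pow_zero, one_mul,
      coeff_zero_eq_constantCoeff_apply]
  refine logOf_eq_of_derivative_eq_mul (by rw [hc, constantCoeff_NCM])
    (by rw [hc, constantCoeff_cycleSeries]) ?_
  rw [derivative_rescale, derivative_rescale, derivative_NCM, map_mul, mul_assoc]

theorem cycleSeries_eq (hj : 2 ≤ j) {τ ρ : Equiv.Perm (Fin j)} {x : R} {y : Rˣ}
    (h : ∀ n, cycleSum (Fin (n + 2)) ρ x (y : R) =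
      x * ((y : R) ^ (n + 2) * cycleSum (Fin (n + 2)) τ 1 ((y⁻¹ : Rˣ) : R))) :
    cycleSeries ρ x (y : R) = C x * (C (y : R) * X - X +
      rescale (y : R) (cycleSeries τ 1 ((y⁻¹ : Rˣ) : R))) := by
  ext n
  rw [coeff_C_mul, map_add, map_sub, coeff_C_mul, coeff_rescale, cycleSeries, cycleSeries,
    coeff_mk, coeff_mk, coeff_X]
  rcases n with _ | _ | n
  · simp
  -- Coefficient of `t`: `x y` on the left, while rescaling gives `y * y⁻¹ = 1`, corrected by `y -
  -- 1`.
  · simp [cycleSum_one hj]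
  · rw [if_neg (by omega), if_neg (by omega), if_neg (by omega), h]
    ring

theorem NCM_eq_of_cycleSum_eq (hj : 2 ≤ j) {τ ρ : Equiv.Perm (Fin j)} {x : R} {y : Rˣ}
    (h : ∀ n, cycleSum (Fin (n + 2)) ρ x (y : R) =
      x * ((y : R) ^ (n + 2) * cycleSum (Fin (n + 2)) τ 1 ((y⁻¹ : Rˣ) : R))) :
    NCM ρ x (y : R) = expOf (C x * (C (y : R) * X - X +
      logOf (rescale (y : R) (NCM τ 1 ((y⁻¹ : Rˣ) : R))))) := by
  rw [NCM_eq_expOf, logOf_rescale_NCM, cycleSeries_eq hj h]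

end GeneratingFunctions

end CyclePattern

theorem mainTheorem5 {R : Type*} [CommRing R] [Algebra ℚ R] {j : ℕ} (hj : 2 ≤ j)
    (τ : Equiv.Perm (Fin j)) (x : R) (y : Rˣ) :
    CyclePattern.NCM (CyclePattern.reverse τ) x (y : R) =
        CyclePattern.NCM (CyclePattern.complement τ) x (y : R) ∧
      CyclePattern.NCM (CyclePattern.complement τ) x (y : R) =
        CyclePattern.expOf (PowerSeries.C x *
          (PowerSeries.C (y : R) * PowerSeries.X - PowerSeries.X +
            PowerSeries.logOf (PowerSeries.rescale (y : R)
              (CyclePattern.NCM τ 1 ((y⁻¹ : Rˣ) : R))))) := by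
  have h := CyclePattern.NCM_eq_of_cycleSum_eq hj fun n =>
    CyclePattern.cycleSum_complement (n := n) τ x y
  exact ⟨(CyclePattern.NCM_eq_of_cycleSum_eq hj fun n =>
    CyclePattern.cycleSum_reverse (n := n) τ x y).trans h.symm, h⟩
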